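/- Let $t\ge 1$ be an integer and let $G$ be a finite simple graph on $n\ge 1$ vertices containing no copy of the path $P_t$ on $t$ vertices as a (not necessarily induced) subgraph. Let $\lambda_n(G)$ denote the least eigenvalue of the adjacency matrix of $G$, and let $K_{a,b}$ be the complete bipartite graph with parts of sizes $a$ and $b$ ($K_{0,b}$ being the graph on $b$ vertices without edges). (i) If $n<t$, then $\lambda_n(G)\ge -\sqrt{\lfloor n/2\rfloor\lceil n/2\rceil}$, and equality holds if and only if $G\cong K_{\lfloor n/2\rfloor,\lceil n/2\rceil}$. (ii) If $n\ge t$ and $t\ne 3$, then, with $k=\lfloor (t-2)/2\rfloor$, $\lambda_n(G)\ge -\sqrt{k(n-k)}$, and equality holds if and only if either $G\cong K_{k,n-k}$, or $n=t=5$ and $G\cong K_{2,2}\cup K_1$ (disjoint union). -/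

import Mathlib

/-- The least eigenvalue of the (real) adjacency matrix of a finite graph. -/
noncomputable def SimpleGraph.leastEigenvalue {V : Type*} [Fintype V] [DecidableEq V]
    (G : SimpleGraph V) [DecidableRel G.Adj] : ℝ :=
  sInf (spectrum ℝ (G.adjMatrix ℝ))

/-- On a nonempty vertex set the infimum is attained: it is the smallest eigenvalue. -/
theorem SimpleGraph.isLeast_leastEigenvalue {V : Type*} [Fintype V] [DecidableEq V] [Nonempty V]
    (G : SimpleGraph V) [DecidableRel G.Adj] :
    IsLeast (spectrum ℝ (G.adjMatrix ℝ)) G.leastEigenvalue := by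
  have hA : (G.adjMatrix ℝ).IsHermitian := by
    rw [Matrix.IsHermitian, Matrix.conjTranspose_eq_transpose_of_trivial]
    exact G.transpose_adjMatrix
  have hs := hA.spectrum_real_eq_range_eigenvalues
  have hfin : (spectrum ℝ (G.adjMatrix ℝ)).Finite := hs ▸ Set.finite_range _
  have hne : (spectrum ℝ (G.adjMatrix ℝ)).Nonempty := hs ▸ Set.range_nonempty _
  exact ⟨hne.csInf_mem hfin, fun _ hx => csInf_le hfin.bddBelow hx⟩

/-! Let x be an eigenvector for the least eigenvalue -r, and split the vertices by the sign of x.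
Edges inside a sign class contribute nonnegatively to the quadratic form, so r‖x‖² is at most twice
the form of the bipartite graph between the classes (`two_mul_crossForm_eq`). By Cauchy-Schwarz, e
edges between the classes give r² ≤ e, and when e ≤ r² every inequality is tight and the adjacencies
are rigid (`adj_structure_of_edgesBetween_le`).

It would thus suffice that e ≤ c = k(n - k), but this can fail: for t = 5, m ≥ 2 disjoint copies of
K_{2,2} have 4m edges while c = 4m - 1. Their singular values are small, however, which is why
`CrossDichotomy` allows a second alternative. It is proved by induction
(`crossDichotomy_of_free_odd`): deleting a vertex of degree at most k lowers c by exactly k, and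
lowers both the edge count and the squared top singular value by at most k. If no such vertex
exists, greedy paths force (k + 1)-regularity, and the Schur test gives the bound (k + 1)² < c.

In the equality case the strict sign classes have sizes p, q with pq = c and are completely joined.
Either one of them has at most k elements, giving K_{k,n-k}, or path-freeness leaves only K_{2,2} ∪
K_1. For n < t the trivial bound e ≤ |A||B| replaces the dichotomy. -/

open Finset

/-! ### Greedy paths in bipartite graphs of large minimum degree. -/

namespace SimpleGraph

variable {V : Type*}

/-- A repetition-free chain of `t` vertices yields a copy of the path on `t` vertices. -/
theorem not_free_pathGraph_of_isChain {G : SimpleGraph V} {l : List V}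
    (hc : l.IsChain G.Adj) (hl : l.Nodup) : ¬ (pathGraph l.length).Free G := by
  rw [not_free]
  refine ⟨⟨⟨fun i => l.get i, ?_⟩, ?_⟩⟩
  · intro i j hij
    rw [List.isChain_iff_getElem] at hc
    rcases pathGraph_adj.1 hij with h | h
    · have := hc i.1 (by omega)
      simpa [h] using this
    · have := hc j.1 (by omega)
      simpa [h] using this.symm
  · exact List.nodup_iff_injective_get.1 hl

theorem free_pathGraph_mono {G : SimpleGraph V} {s t : ℕ} (hst : s ≤ t) (h : (pathGraph s).Free G) :
    (pathGraph t).Free G := by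
  refine fun ht => h (IsContained.trans ⟨⟨⟨Fin.castLE hst, fun {i j} hij => ?_⟩, ?_⟩⟩ ht)
  · rw [pathGraph_adj] at hij ⊢
    simpa using hij
  · exact Fin.castLE_injective hst

variable [DecidableEq V] (G : SimpleGraph V) [DecidableRel G.Adj]

/-- The number of neighbours of `u` in `B`. -/
def degreeIn (B : Finset V) (u : V) : ℕ := #{v ∈ B | G.Adj u v}

variable {G}

theorem exists_mem_adj_of_card_lt_degreeIn {B C : Finset V} {u : V}
    (h : #(C ∩ B) < G.degreeIn B u) : ∃ v ∈ B, v ∉ C ∧ G.Adj u v := by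
  obtain ⟨v, hv, hvC⟩ := exists_mem_notMem_of_card_lt_card h
  rw [mem_filter] at hv
  exact ⟨v, hv.1, fun hC => hvC (mem_inter.2 ⟨hC, hv.1⟩), hv.2⟩

theorem degreeIn_le_degreeIn_erase_add_one (B : Finset V) (u v : V) :
    G.degreeIn B u ≤ G.degreeIn (B.erase v) u + 1 := by
  unfold degreeIn
  rw [filter_erase]
  have := pred_card_le_card_erase (s := {w ∈ B | G.Adj u w}) (a := v)
  omega

/-- In a bipartite graph with minimum degree at least `k + 1` every vertex is the end of a path on
`2 * k + 2` vertices. -/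
theorem exists_path_of_le_degreeIn (k : ℕ) : ∀ {A B : Finset V}, Disjoint A B →
    (∀ u ∈ A, k + 1 ≤ G.degreeIn B u) → (∀ v ∈ B, k + 1 ≤ G.degreeIn A v) →
    ∀ u ∈ A, ∃ l : List V, (u :: l).IsChain G.Adj ∧ (u :: l).Nodup ∧ l.length = 2 * k + 1 ∧
      (∀ w ∈ u :: l, w ∈ A ∪ B) ∧ #((u :: l).toFinset ∩ B) ≤ k + 1 := by
  induction k with
  | zero =>
    intro A B hAB hA hB u hu
    obtain ⟨v, hv, -, huv⟩ := exists_mem_adj_of_card_lt_degreeIn (G := G) (C := ∅) (B := B) (u := u)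
      (by rw [empty_inter, card_empty]; exact hA u hu)
    have huB : u ∉ B := Finset.disjoint_left.1 hAB hu
    refine ⟨[v], by simpa using huv, by simpa using huv.ne, rfl, by simp [hu, hv], ?_⟩
    simp [insert_inter_of_notMem huB, card_le_one]
  | succ k ih =>
    intro A B hAB hA hB u hu
    obtain ⟨v, hv, -, huv⟩ := exists_mem_adj_of_card_lt_degreeIn (G := G) (C := ∅) (B := B) (u := u)
      (by rw [empty_inter, card_empty]; exact (Nat.succ_pos _).trans_le (hA u hu))
    have huB : u ∉ B := Finset.disjoint_left.1 hAB hu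
    obtain ⟨w, hw, hwu, hvw⟩ := exists_mem_adj_of_card_lt_degreeIn (G := G) (C := {u}) (B := A) (u := v)
      (by have := hB v hv; have := card_le_card (inter_subset_left (s₁ := {u}) (s₂ := A))
          rw [card_singleton] at this; omega)
    have hvA : v ∉ A := Finset.disjoint_right.1 hAB hv
    -- Deleting u and v costs each remaining vertex at most one neighbour on the opposite side,
    -- which is what the lower degree bound of the induction hypothesis absorbs.
    obtain ⟨l, hc, hn, hlen, hmem, hcard⟩ := ih (A := A.erase u) (B := B.erase v)
      (hAB.mono (erase_subset _ _) (erase_subset _ _))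
      (fun x hx => by
        have := hA x (mem_of_mem_erase hx)
        have := degreeIn_le_degreeIn_erase_add_one (G := G) B x v
        omega)
      (fun x hx => by
        have := hB x (mem_of_mem_erase hx)
        have := degreeIn_le_degreeIn_erase_add_one (G := G) A x u
        omega) w (mem_erase.2 ⟨by simpa using hwu, hw⟩)
    have hul : u ∉ w :: l := fun h => by
      have := hmem u h
      simp [huB] at this
    have hvl : v ∉ w :: l := fun h => by
      have := hmem v h
      simp [hvA] at this
    refine ⟨v :: w :: l, ?_, ?_, ?_, ?_, ?_⟩
    · exact List.IsChain.cons_cons huv (List.IsChain.cons_cons hvw hc)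
    · refine List.nodup_cons.2 ⟨?_, List.nodup_cons.2 ⟨hvl, hn⟩⟩
      rw [List.mem_cons]
      rintro (h | h)
      exacts [huv.ne h, hul h]
    · simp only [List.length_cons]; omega
    · intro x hx
      rw [List.mem_cons, List.mem_cons] at hx
      rcases hx with rfl | rfl | hx
      · simp [hu]
      · simp [hv]
      · have := hmem x hx
        simp only [mem_union, mem_erase] at this ⊢
        tauto
    · have hsub : (u :: v :: w :: l).toFinset ∩ B ⊆
          insert v ((w :: l).toFinset ∩ B.erase v) := by
        intro x hx
        rw [mem_inter, List.mem_toFinset, List.mem_cons, List.mem_cons] at hx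
        rw [mem_insert, mem_inter, List.mem_toFinset, mem_erase]
        obtain ⟨rfl | rfl | hx, hxB⟩ := hx
        · exact absurd hxB huB
        · exact Or.inl rfl
        · by_cases hxv : x = v
          · exact Or.inl hxv
          · exact Or.inr ⟨hx, hxv, hxB⟩
      have := card_le_card hsub
      have := card_insert_le v ((w :: l).toFinset ∩ B.erase v)
      omega

theorem not_free_pathGraph_even {k : ℕ} {A B : Finset V} (hAB : Disjoint A B)
    (hA : ∀ u ∈ A, k + 1 ≤ G.degreeIn B u) (hB : ∀ v ∈ B, k + 1 ≤ G.degreeIn A v)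
    {u : V} (hu : u ∈ A) : ¬ (pathGraph (2 * k + 2)).Free G := by
  obtain ⟨l, hc, hn, hlen, -⟩ := exists_path_of_le_degreeIn k hAB hA hB u hu
  have := not_free_pathGraph_of_isChain hc hn
  rwa [List.length_cons, hlen] at this

/-- A path on `2 * k + 2` vertices from `u` extends backwards to a neighbour `w` of `u` outside. -/
theorem not_free_pathGraph_odd_of_adj {k : ℕ} {A B : Finset V} (hAB : Disjoint A B)
    (hA : ∀ u ∈ A, k + 1 ≤ G.degreeIn B u) (hB : ∀ v ∈ B, k + 1 ≤ G.degreeIn A v)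
    {u w : V} (hu : u ∈ A) (hwA : w ∉ A) (hwB : w ∉ B) (hwu : G.Adj w u) :
    ¬ (pathGraph (2 * k + 3)).Free G := by
  obtain ⟨l, hc, hn, hlen, hmem, -⟩ := exists_path_of_le_degreeIn k hAB hA hB u hu
  have := not_free_pathGraph_of_isChain (l := w :: u :: l) (List.IsChain.cons_cons hwu hc)
    (List.nodup_cons.2 ⟨fun h => by simpa [hwA, hwB] using hmem w h, hn⟩)
  rwa [List.length_cons, List.length_cons, hlen] at this

/-- The greedy path from u uses at most k + 1 vertices of B, so u has a neighbour off the path that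
can be put in front of it. -/
theorem not_free_pathGraph_odd_of_lt_degreeIn {k : ℕ} {A B : Finset V} (hAB : Disjoint A B)
    (hA : ∀ u ∈ A, k + 1 ≤ G.degreeIn B u) (hB : ∀ v ∈ B, k + 1 ≤ G.degreeIn A v)
    {u : V} (hu : u ∈ A) (hd : k + 1 < G.degreeIn B u) :
    ¬ (pathGraph (2 * k + 3)).Free G := by
  obtain ⟨l, hc, hn, hlen, hmem, hcard⟩ := exists_path_of_le_degreeIn k hAB hA hB u hu
  obtain ⟨w, -, hw, huw⟩ := exists_mem_adj_of_card_lt_degreeIn (hcard.trans_lt hd)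
  rw [List.mem_toFinset] at hw
  have := not_free_pathGraph_of_isChain (l := w :: u :: l) (List.IsChain.cons_cons huw.symm hc)
    (List.nodup_cons.2 ⟨hw, hn⟩)
  rwa [List.length_cons, List.length_cons, hlen] at this

end SimpleGraph

/-! ### Edge counts and singular values between two vertex classes. -/

namespace SimpleGraph

variable {V : Type*} (G : SimpleGraph V) [DecidableRel G.Adj]

/-- The number of edges between `A` and `B`, for disjoint `A` and `B`. -/
def edgesBetween (A B : Finset V) : ℕ := ∑ u ∈ A, G.degreeIn B u

/-- The bilinear form of the bipartite graph induced between `A` and `B`. -/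
noncomputable def crossForm (A B : Finset V) (a b : V → ℝ) : ℝ :=
  ∑ u ∈ A, ∑ v ∈ B, G.adjMatrix ℝ u v * (a u * b v)

/-- The square of the largest singular value of the biadjacency matrix between `A` and `B` is at
most `c`. -/
def CrossBound (A B : Finset V) (c : ℝ) : Prop :=
  ∀ a b : V → ℝ, G.crossForm A B a b ^ 2 ≤ c * (∑ u ∈ A, a u ^ 2) * ∑ v ∈ B, b v ^ 2

/-- Either there are at most `c` edges between `A` and `B`, or the spectral bound `c` holds there
with room to spare. -/
def CrossDichotomy (A B : Finset V) (c : ℝ) : Prop :=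
  (G.edgesBetween A B : ℝ) ≤ c ∨ ∃ c', 0 ≤ c' ∧ c' < c ∧ G.CrossBound A B c'

variable {G}

theorem natCast_degreeIn (B : Finset V) (u : V) :
    (G.degreeIn B u : ℝ) = ∑ v ∈ B, G.adjMatrix ℝ u v := by
  simp [degreeIn, adjMatrix_apply]

theorem adjMatrix_symm (u v : V) : G.adjMatrix ℝ u v = G.adjMatrix ℝ v u := by
  simp [adjMatrix_apply, G.adj_comm]

theorem adjMatrix_sq (u v : V) : G.adjMatrix ℝ u v ^ 2 = G.adjMatrix ℝ u v := by
  by_cases h : G.Adj u v <;> simp [h]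

theorem adjMatrix_nonneg (u v : V) : 0 ≤ G.adjMatrix ℝ u v := by
  by_cases h : G.Adj u v <;> simp [h]

theorem natCast_edgesBetween (A B : Finset V) :
    (G.edgesBetween A B : ℝ) = ∑ u ∈ A, ∑ v ∈ B, G.adjMatrix ℝ u v := by
  simp [edgesBetween, natCast_degreeIn]

theorem edgesBetween_comm (A B : Finset V) : G.edgesBetween A B = G.edgesBetween B A := by
  have : (G.edgesBetween A B : ℝ) = G.edgesBetween B A := by
    rw [natCast_edgesBetween, natCast_edgesBetween]
    refine Finset.sum_comm.trans (sum_congr rfl fun v _ => sum_congr rfl fun u _ => ?_)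
    exact adjMatrix_symm u v
  exact_mod_cast this

theorem crossForm_comm (A B : Finset V) (a b : V → ℝ) :
    G.crossForm A B a b = G.crossForm B A b a := by
  rw [crossForm, crossForm, sum_comm]
  refine sum_congr rfl fun v _ => sum_congr rfl fun u _ => ?_
  rw [adjMatrix_symm, mul_comm (a u)]

theorem CrossBound.symm {A B : Finset V} {c : ℝ} (h : G.CrossBound A B c) :
    G.CrossBound B A c := fun a b => by
  rw [crossForm_comm, mul_right_comm]
  exact h b a

theorem CrossDichotomy.symm {A B : Finset V} {c : ℝ} (h : G.CrossDichotomy A B c) :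
    G.CrossDichotomy B A c := by
  rcases h with h | ⟨c', h0, hc, h⟩
  · exact Or.inl (by rwa [edgesBetween_comm])
  · exact Or.inr ⟨c', h0, hc, h.symm⟩

theorem degreeIn_le_card (B : Finset V) (u : V) : G.degreeIn B u ≤ #B := card_filter_le _ _

theorem edgesBetween_le_card_mul_card (A B : Finset V) : G.edgesBetween A B ≤ #A * #B := by
  rw [edgesBetween, ← smul_eq_mul]
  exact sum_le_card_nsmul _ _ _ fun u _ => degreeIn_le_card B u

theorem degreeIn_eq_card_of_edgesBetween_eq {A B : Finset V}
    (h : G.edgesBetween A B = #A * #B) : ∀ u ∈ A, G.degreeIn B u = #B := by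
  rw [edgesBetween, ← smul_eq_mul, ← sum_const] at h
  exact (sum_eq_sum_iff_of_le fun u _ => degreeIn_le_card B u).1 h

/-- Schur test for a bipartite graph with bounded degrees. -/
theorem crossBound_of_degreeIn_le {A B : Finset V} {d : ℕ}
    (hA : ∀ u ∈ A, G.degreeIn B u ≤ d) (hB : ∀ v ∈ B, G.degreeIn A v ≤ d) :
    G.CrossBound A B ((d : ℝ) ^ 2) := by
  intro a b
  -- Cauchy-Schwarz over the pairs; the 0/1 entries equal their squares, so each factor can carry a
  -- copy.
  have h1 : G.crossForm A B a b ^ 2 ≤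
      (∑ p ∈ A ×ˢ B, (G.adjMatrix ℝ p.1 p.2 * a p.1) ^ 2) *
        ∑ p ∈ A ×ˢ B, (G.adjMatrix ℝ p.1 p.2 * b p.2) ^ 2 := by
    refine le_of_eq_of_le ?_ (sum_mul_sq_le_sq_mul_sq (A ×ˢ B) _ _)
    rw [crossForm, sum_product]
    congr 1
    refine sum_congr rfl fun u _ => sum_congr rfl fun v _ => ?_
    linear_combination -(a u * b v) * adjMatrix_sq (G := G) u v
  have h2 : ∑ p ∈ A ×ˢ B, (G.adjMatrix ℝ p.1 p.2 * a p.1) ^ 2 ≤ d * ∑ u ∈ A, a u ^ 2 := by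
    rw [sum_product, mul_sum]
    refine sum_le_sum fun u hu => ?_
    simp_rw [mul_pow, adjMatrix_sq]
    rw [← sum_mul, ← natCast_degreeIn]
    gcongr
    exact hA u hu
  have h3 : ∑ p ∈ A ×ˢ B, (G.adjMatrix ℝ p.1 p.2 * b p.2) ^ 2 ≤ d * ∑ v ∈ B, b v ^ 2 := by
    rw [sum_product_right, mul_sum]
    refine sum_le_sum fun v hv => ?_
    simp_rw [mul_pow, adjMatrix_sq, adjMatrix_symm (G := G) _ v]
    rw [← sum_mul, ← natCast_degreeIn]
    gcongr
    exact hB v hv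
  calc _ ≤ _ := h1
    _ ≤ (d * ∑ u ∈ A, a u ^ 2) * (d * ∑ v ∈ B, b v ^ 2) := by gcongr
    _ = _ := by ring

/-- The defect in the bound of the cross form by the number of edges. -/
theorem sum_sq_sub_smul_adjMatrix (A B : Finset V) (a b : V → ℝ) (s : ℝ) :
    ∑ u ∈ A, ∑ v ∈ B, (a u * b v - s * G.adjMatrix ℝ u v) ^ 2 =
      (∑ u ∈ A, a u ^ 2) * (∑ v ∈ B, b v ^ 2) - 2 * s * G.crossForm A B a b +
        s ^ 2 * G.edgesBetween A B := by
  rw [natCast_edgesBetween, crossForm, sum_mul_sum, mul_sum, mul_sum, ← sum_sub_distrib,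
    ← sum_add_distrib]
  refine sum_congr rfl fun u _ => ?_
  rw [mul_sum, mul_sum, ← sum_sub_distrib, ← sum_add_distrib]
  refine sum_congr rfl fun v _ => ?_
  rw [sub_sq, mul_pow, mul_pow, adjMatrix_sq]
  ring

variable [DecidableEq V]

theorem edgesBetween_erase_add {A : Finset V} {u : V} (B : Finset V) (hu : u ∈ A) :
    G.edgesBetween (A.erase u) B + G.degreeIn B u = G.edgesBetween A B :=
  sum_erase_add _ _ hu

/-- Deleting a vertex `u` decreases the square of the spectral radius of a bipartite graph by at
most the degree of `u`. -/
theorem CrossBound.of_erase {A B : Finset V} {c : ℝ} {d : ℕ} {u : V} (hu : u ∈ A) (hc : 0 ≤ c)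
    (hd : G.degreeIn B u ≤ d) (h : G.CrossBound (A.erase u) B c) :
    G.CrossBound A B (c + d) := by
  intro a b
  have h1 := h a b
  have hform : G.crossForm A B a b =
      G.crossForm (A.erase u) B a b + a u * ∑ v ∈ B, G.adjMatrix ℝ u v * b v := by
    rw [crossForm, crossForm, ← sum_erase_add _ _ hu, mul_sum]
    congr 1
    exact sum_congr rfl fun v _ => by ring
  have hsum : ∑ w ∈ A, a w ^ 2 = ∑ w ∈ A.erase u, a w ^ 2 + a u ^ 2 := (sum_erase_add _ _ hu).symm
  have hs : (∑ v ∈ B, G.adjMatrix ℝ u v * b v) ^ 2 ≤ d * ∑ v ∈ B, b v ^ 2 := by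
    refine (sum_mul_sq_le_sq_mul_sq B _ _).trans ?_
    gcongr
    simp_rw [adjMatrix_sq]
    rw [← natCast_degreeIn]
    exact_mod_cast hd
  rw [hform, hsum]
  have hP : 0 ≤ ∑ w ∈ A.erase u, a w ^ 2 := by positivity
  have hN : 0 ≤ ∑ v ∈ B, b v ^ 2 := by positivity
  have hd0 : (0 : ℝ) ≤ d := d.cast_nonneg
  generalize ∑ v ∈ B, G.adjMatrix ℝ u v * b v = s at *
  generalize G.crossForm (A.erase u) B a b = f at *
  generalize ∑ w ∈ A.erase u, a w ^ 2 = P at *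
  generalize ∑ v ∈ B, b v ^ 2 = N at *
  generalize a u = x at *
  generalize (d : ℝ) = D at *
  -- The mixed term of (f + xs)², by AM-GM from f² ≤ cPN and s² ≤ DN. Together with the two squares
  -- it completes (c + D)(P + x²)N.
  have key : 2 * (f * (x * s)) ≤ (c * x ^ 2 + D * P) * N := by
    refine le_of_sq_le_sq ?_ (by positivity)
    calc (2 * (f * (x * s))) ^ 2 = 4 * x ^ 2 * (f ^ 2 * s ^ 2) := by ring
      _ ≤ 4 * x ^ 2 * ((c * P * N) * (D * N)) := by gcongr
      _ ≤ ((c * x ^ 2 + D * P) * N) ^ 2 := by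
        nlinarith [mul_nonneg (sq_nonneg (c * x ^ 2 - D * P)) (sq_nonneg N)]
  nlinarith [mul_le_mul_of_nonneg_left hs (sq_nonneg x)]

theorem CrossDichotomy.of_erase {A B : Finset V} {c : ℝ} {d : ℕ} {u : V} (hu : u ∈ A)
    (hd : G.degreeIn B u ≤ d) (h : G.CrossDichotomy (A.erase u) B c) :
    G.CrossDichotomy A B (c + d) := by
  rcases h with h | ⟨c', h0, hc, h⟩
  · left
    rw [← edgesBetween_erase_add B hu]
    push_cast
    have : (G.degreeIn B u : ℝ) ≤ d := by exact_mod_cast hd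
    linarith
  · exact Or.inr ⟨c' + d, by positivity, by linarith, h.of_erase hu h0 hd⟩

end SimpleGraph

/-! ### The dichotomy for path-free bipartite graphs. -/

namespace SimpleGraph

variable {V : Type*} {G : SimpleGraph V} [DecidableRel G.Adj]

/-- Since k(k + 2) = (k + 1)² - 1, a single missing edge or any imbalance of the parts already
brings the count down to k(k + 2). -/
theorem edgesBetween_eq_of_card_eq {k : ℕ} {A B : Finset V} (hn : #A + #B = 2 * k + 2)
    (he : k * (k + 2) < G.edgesBetween A B) :
    #A = k + 1 ∧ #B = k + 1 ∧ G.edgesBetween A B = (k + 1) * (k + 1) := by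
  have h := edgesBetween_le_card_mul_card (G := G) A B
  have hA : #A = k + 1 := by
    obtain ⟨d, hd⟩ | ⟨d, hd⟩ : (∃ d, #A = k + 1 + d) ∨ ∃ d, #B = k + 1 + d := by
      rcases le_total (k + 1) #A with h | h
      · exact Or.inl (Nat.exists_eq_add_of_le h)
      · exact Or.inr (Nat.exists_eq_add_of_le (by omega))
    · rcases Nat.eq_zero_or_pos d with rfl | hd0
      · exact hd
      · have hB : #B + d = k + 1 := by omega
        nlinarith
    · rcases Nat.eq_zero_or_pos d with rfl | hd0
      · omega
      · have hB : #A + d = k + 1 := by omega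
        nlinarith
  have hB : #B = k + 1 := by omega
  rw [hA, hB] at h
  exact ⟨hA, hB, le_antisymm h (by nlinarith)⟩

variable [DecidableEq V]

/-- Deletion of a vertex of degree at most `k` from a bipartite graph on `2 * k + 3` vertices. -/
theorem edgesBetween_le_of_degreeIn_le {k : ℕ} (hk : 1 ≤ k)
    (hfree : (pathGraph (2 * k + 3)).Free G) {A B : Finset V} (hAB : Disjoint A B)
    (hn : #A + #B = 2 * k + 3) {u : V} (hu : u ∈ A) (hd : G.degreeIn B u ≤ k) :
    G.edgesBetween A B ≤ k * (k + 3) := by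
  have hadd := edgesBetween_erase_add (G := G) B hu
  have hcard := card_erase_add_one hu
  by_cases he : G.edgesBetween (A.erase u) B ≤ k * (k + 2)
  · nlinarith
  obtain ⟨hA, hB, he⟩ := edgesBetween_eq_of_card_eq (by omega) (not_le.1 he)
  have hdA := degreeIn_eq_card_of_edgesBetween_eq (G := G) (A := A.erase u) (B := B)
    (by rw [he, hA, hB])
  have hdB := degreeIn_eq_card_of_edgesBetween_eq (G := G) (A := B) (B := A.erase u)
    (by rw [edgesBetween_comm, he, hA, hB])
  have huB : u ∉ B := Finset.disjoint_left.1 hAB hu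
  -- The rest is K_{k+1,k+1}, and (k + 1)² ≤ k(k + 3) because k ≥ 1. Equality at k = 1 is the source
  -- of the exceptional graph K_{2,2} ∪ K_1.
  suffices G.degreeIn B u = 0 by nlinarith
  by_contra h0
  obtain ⟨v, hv, -, huv⟩ := exists_mem_adj_of_card_lt_degreeIn (G := G) (C := ∅) (B := B) (u := u)
    (by rw [empty_inter, card_empty]; omega)
  exact not_free_pathGraph_odd_of_adj (k := k) (A := B) (B := A.erase u)
    (hAB.symm.mono_right (erase_subset _ _)) (fun x hx => (hdB x hx).symm ▸ hA.ge)
    (fun x hx => (hdA x hx).symm ▸ hB.ge) hv huB (notMem_erase u A) huv hfree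

/-- A bipartite graph of minimum degree greater than `k` without a path on `2 * k + 3` vertices is
`k + 1`-regular. -/
theorem exists_crossBound_lt_of_lt_degreeIn {k : ℕ} (hk : 1 ≤ k)
    (hfree : (pathGraph (2 * k + 3)).Free G) {A B : Finset V} (hAB : Disjoint A B)
    (hn : 2 * k + 3 ≤ #A + #B) (hA : ∀ u ∈ A, k + 1 ≤ G.degreeIn B u)
    (hB : ∀ v ∈ B, k + 1 ≤ G.degreeIn A v) :
    ∃ c : ℝ, 0 ≤ c ∧ c < k * (((#A + #B : ℕ) : ℝ) - k) ∧ G.CrossBound A B c := by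
  have hA' : ∀ u ∈ A, G.degreeIn B u ≤ k + 1 := fun u hu => not_lt.1 fun h =>
    not_free_pathGraph_odd_of_lt_degreeIn hAB hA hB hu h hfree
  have hB' : ∀ v ∈ B, G.degreeIn A v ≤ k + 1 := fun v hv => not_lt.1 fun h =>
    not_free_pathGraph_odd_of_lt_degreeIn hAB.symm hB hA hv h hfree
  have hcard : #A = #B := by
    have h := edgesBetween_comm (G := G) A B
    rw [edgesBetween, edgesBetween, sum_congr rfl fun u hu => (hA' u hu).antisymm (hA u hu),
      sum_congr rfl fun v hv => (hB' v hv).antisymm (hB v hv), sum_const, sum_const] at h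
    exact Nat.eq_of_mul_eq_mul_right k.succ_pos h
  refine ⟨((k + 1 : ℕ) : ℝ) ^ 2, by positivity, ?_, crossBound_of_degreeIn_le hA' hB'⟩
  -- Equal parts make the number of vertices even. This gain of one is needed: with 2k + 3 vertices,
  -- (k + 1)² < k(k + 3) fails for k = 1.
  have h4 : ((2 * k + 4 : ℕ) : ℝ) ≤ (#A + #B : ℕ) := Nat.cast_le.2 (by omega)
  have hk' : (1 : ℝ) ≤ k := by exact_mod_cast hk
  have := mul_le_mul_of_nonneg_left h4 (by positivity : (0 : ℝ) ≤ k)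
  push_cast at this ⊢
  nlinarith

/-- The extremal dichotomy for bipartite graphs without a path on `2 * k + 3` vertices. -/
theorem crossDichotomy_of_free_odd {k : ℕ} (hk : 1 ≤ k)
    (hfree : (pathGraph (2 * k + 3)).Free G) (n : ℕ) (hn : 2 * k + 3 ≤ n) :
    ∀ {A B : Finset V}, Disjoint A B → #A + #B = n → G.CrossDichotomy A B (k * ((n : ℝ) - k)) := by
  induction n, hn using Nat.le_induction with
  | base =>
    intro A B hAB hcard
    have hcast : (k : ℝ) * (((2 * k + 3 : ℕ) : ℝ) - k) = (k * (k + 3) : ℕ) := by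
      push_cast; ring
    by_cases hA : ∀ u ∈ A, k + 1 ≤ G.degreeIn B u
    · by_cases hB : ∀ v ∈ B, k + 1 ≤ G.degreeIn A v
      · rw [← hcard]
        exact Or.inr (exists_crossBound_lt_of_lt_degreeIn hk hfree hAB hcard.ge hA hB)
      · push Not at hB
        obtain ⟨v, hv, hd⟩ := hB
        left
        rw [hcast, edgesBetween_comm, Nat.cast_le]
        exact edgesBetween_le_of_degreeIn_le hk hfree hAB.symm (by omega) hv (by omega)
    · push Not at hA
      obtain ⟨u, hu, hd⟩ := hA
      left
      rw [hcast, Nat.cast_le]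
      exact edgesBetween_le_of_degreeIn_le hk hfree hAB hcard hu (by omega)
  | succ n hn ih =>
    intro A B hAB hcard
    have hcast : (k : ℝ) * (((n + 1 : ℕ) : ℝ) - k) = k * ((n : ℝ) - k) + k := by
      push_cast; ring
    by_cases hA : ∀ u ∈ A, k + 1 ≤ G.degreeIn B u
    · by_cases hB : ∀ v ∈ B, k + 1 ≤ G.degreeIn A v
      · rw [← hcard]
        exact Or.inr (exists_crossBound_lt_of_lt_degreeIn hk hfree hAB (by omega) hA hB)
      · push Not at hB
        obtain ⟨v, hv, hd⟩ := hB
        have := card_erase_add_one hv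
        rw [hcast]
        exact (CrossDichotomy.of_erase hv (by omega)
          (ih (hAB.symm.mono_left (erase_subset _ _)) (by omega))).symm
    · push Not at hA
      obtain ⟨u, hu, hd⟩ := hA
      have := card_erase_add_one hu
      rw [hcast]
      exact CrossDichotomy.of_erase hu (by omega)
        (ih (hAB.mono_left (erase_subset _ _)) (by omega))

/-- Only t = n = 2k + 2 escapes the odd case; there too many edges would force K_{k+1,k+1}, which
contains the forbidden path. -/
theorem crossDichotomy_of_free {k t n : ℕ} (hk : 1 ≤ k) (ht : t = 2 * k + 2 ∨ t = 2 * k + 3)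
    (hfree : (pathGraph t).Free G) (htn : t ≤ n) {A B : Finset V} (hAB : Disjoint A B)
    (hcard : #A + #B = n) : G.CrossDichotomy A B (k * ((n : ℝ) - k)) := by
  by_cases hn : 2 * k + 3 ≤ n
  · exact crossDichotomy_of_free_odd hk (free_pathGraph_mono (by omega) hfree) n hn hAB hcard
  obtain rfl : t = 2 * k + 2 := by omega
  obtain rfl : n = 2 * k + 2 := by omega
  left
  have hcast : (k : ℝ) * (((2 * k + 2 : ℕ) : ℝ) - k) = (k * (k + 2) : ℕ) := by
    push_cast; ring
  rw [hcast, Nat.cast_le]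
  by_contra! he
  obtain ⟨hA, hB, he⟩ := edgesBetween_eq_of_card_eq hcard he
  have hdA := degreeIn_eq_card_of_edgesBetween_eq (G := G) (A := A) (B := B)
    (by rw [he, hA, hB])
  have hdB := degreeIn_eq_card_of_edgesBetween_eq (G := G) (A := B) (B := A)
    (by rw [edgesBetween_comm, he, hA, hB])
  obtain ⟨u, hu⟩ : A.Nonempty := card_pos.1 (by omega)
  exact not_free_pathGraph_even (k := k) hAB (fun x hx => (hdA x hx).symm ▸ hB.ge)
    (fun x hx => (hdB x hx).symm ▸ hA.ge) hu hfree

end SimpleGraph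

/-! ### From the bipartite bounds to the least eigenvalue. -/

namespace SimpleGraph

variable {V : Type*} [Fintype V] {G : SimpleGraph V} [DecidableRel G.Adj]

theorem sum_sq_posPart_add_sum_sq_negPart_pos {x : V → ℝ} (hx : x ≠ 0) :
    0 < ∑ u, x⁺ u ^ 2 + ∑ u, x⁻ u ^ 2 := by
  obtain ⟨u, hu⟩ := Function.ne_iff.1 hx
  rw [← sum_add_distrib]
  refine sum_pos' (fun v _ => by positivity) ⟨u, mem_univ u, ?_⟩
  rcases lt_or_gt_of_ne hu with h | h
  · have : 0 < x⁻ u := negPart_pos h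
    positivity
  · have : 0 < x⁺ u := posPart_pos h
    positivity

theorem sum_same_sign_nonneg (x : V → ℝ) :
    0 ≤ ∑ u, ∑ v, G.adjMatrix ℝ u v * (x⁺ u * x⁺ v + x⁻ u * x⁻ v) :=
  sum_nonneg fun u _ => sum_nonneg fun v _ => mul_nonneg (adjMatrix_nonneg u v)
    (add_nonneg (mul_nonneg (posPart_nonneg (x u)) (posPart_nonneg (x v)))
      (mul_nonneg (negPart_nonneg (x u)) (negPart_nonneg (x v))))

variable [DecidableEq V]

theorem mem_spectrum_adjMatrix_iff {μ : ℝ} : μ ∈ spectrum ℝ (G.adjMatrix ℝ) ↔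
    ∃ x : V → ℝ, x ≠ 0 ∧ ∀ u, ∑ v, G.adjMatrix ℝ u v * x v = μ * x u := by
  rw [← Matrix.spectrum_toLin', ← Module.End.hasEigenvalue_iff_mem_spectrum]
  constructor
  · intro h
    obtain ⟨x, hx⟩ := h.exists_hasEigenvector
    refine ⟨x, hx.2, fun u => ?_⟩
    simpa [Matrix.mulVec, dotProduct] using congrFun hx.apply_eq_smul u
  · rintro ⟨x, hx0, hx⟩
    refine Module.End.hasEigenvalue_of_hasEigenvector (x := x)
      (Module.End.hasEigenvector_iff.2 ⟨Module.End.mem_eigenspace_iff.2 ?_, hx0⟩)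
    ext u
    simpa [Matrix.mulVec, dotProduct] using hx u

theorem crossForm_filter_eq_univ (x : V → ℝ) :
    G.crossForm {u | 0 ≤ x u} {u | x u < 0} x⁺ x⁻ = G.crossForm univ univ x⁺ x⁻ := by
  unfold crossForm
  refine sum_subset_zero_on_sdiff (subset_univ _) (fun u hu => ?_) fun u hu =>
    sum_subset_zero_on_sdiff (subset_univ _) (fun v hv => ?_) fun v hv => rfl
  · have : x u < 0 := by simpa using hu
    simp [posPart_eq_zero.2 this.le]
  · have : 0 ≤ x v := by simpa using hv
    simp [negPart_eq_zero.2 this]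

/-- Evaluate the quadratic form at x twice: by the eigenvalue equation, and by expanding x = x⁺ -
x⁻. -/
theorem two_mul_crossForm_eq {x : V → ℝ} {r : ℝ}
    (hx : ∀ u, ∑ v, G.adjMatrix ℝ u v * x v = -r * x u) :
    2 * G.crossForm {u | 0 ≤ x u} {u | x u < 0} x⁺ x⁻ = r * (∑ u, x⁺ u ^ 2 + ∑ u, x⁻ u ^ 2) +
      ∑ u, ∑ v, G.adjMatrix ℝ u v * (x⁺ u * x⁺ v + x⁻ u * x⁻ v) := by
  rw [crossForm_filter_eq_univ, two_mul]
  nth_rewrite 2 [crossForm_comm]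
  have hsub : ∀ u, x u = x⁺ u - x⁻ u := fun u => (posPart_sub_negPart (x u)).symm
  have hmul : ∀ u, x⁺ u * x⁻ u = 0 := fun u => by
    rcases le_total 0 (x u) with h | h
    · simp [negPart_eq_zero.2 h]
    · simp [posPart_eq_zero.2 h]
  have h : ∑ u, x u * ∑ v, G.adjMatrix ℝ u v * x v =
      -r * (∑ u, x⁺ u ^ 2 + ∑ u, x⁻ u ^ 2) := by
    rw [← sum_add_distrib, mul_sum]
    refine sum_congr rfl fun u _ => ?_
    rw [hx u, hsub u]
    linear_combination (2 * r) * hmul u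
  have h' : ∑ u, x u * ∑ v, G.adjMatrix ℝ u v * x v =
      ∑ u, ∑ v, G.adjMatrix ℝ u v * (x⁺ u * x⁺ v + x⁻ u * x⁻ v) -
        (G.crossForm univ univ x⁺ x⁻ + G.crossForm univ univ x⁻ x⁺) := by
    unfold crossForm
    rw [← sum_add_distrib, ← sum_sub_distrib]
    refine sum_congr rfl fun u _ => ?_
    rw [← sum_add_distrib, ← sum_sub_distrib, mul_sum]
    refine sum_congr rfl fun v _ => ?_
    rw [hsub u, hsub v]
    ring
  linarith

theorem sum_posPart_sq_filter (x : V → ℝ) :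
    ∑ u with 0 ≤ x u, x⁺ u ^ 2 = ∑ u, x⁺ u ^ 2 := by
  refine sum_subset_zero_on_sdiff (subset_univ _) (fun u hu => ?_) fun u hu => rfl
  have : x u < 0 := by simpa using hu
  simp [posPart_eq_zero.2 this.le]

theorem sum_negPart_sq_filter (x : V → ℝ) :
    ∑ u with x u < 0, x⁻ u ^ 2 = ∑ u, x⁻ u ^ 2 := by
  refine sum_subset_zero_on_sdiff (subset_univ _) (fun u hu => ?_) fun u hu => rfl
  have : 0 ≤ x u := by simpa using hu
  simp [negPart_eq_zero.2 this]

/-- A spectral bound between the sign classes of an eigenvector bounds its eigenvalue. -/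
theorem CrossBound.sq_le {x : V → ℝ} {r c : ℝ} (hx0 : x ≠ 0) (hr : 0 ≤ r) (hc : 0 ≤ c)
    (hx : ∀ u, ∑ v, G.adjMatrix ℝ u v * x v = -r * x u)
    (h : G.CrossBound {u | 0 ≤ x u} {u | x u < 0} c) : r ^ 2 ≤ c := by
  have h1 := h x⁺ x⁻
  rw [sum_posPart_sq_filter, sum_negPart_sq_filter] at h1
  have h2 := two_mul_crossForm_eq hx
  have hS := sum_same_sign_nonneg (G := G) x
  have hN := sum_sq_posPart_add_sum_sq_negPart_pos hx0
  set F := G.crossForm {u | 0 ≤ x u} {u | x u < 0} x⁺ x⁻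
  set P := ∑ u, x⁺ u ^ 2
  set Q := ∑ u, x⁻ u ^ 2
  have h3 : (r * (P + Q)) ^ 2 ≤ (2 * F) ^ 2 :=
    pow_le_pow_left₀ (by positivity) (by linarith) 2
  refine le_of_mul_le_mul_right (a := (P + Q) ^ 2) ?_ (by positivity)
  nlinarith [mul_nonneg hc (sq_nonneg (P - Q))]

/-- If the number of edges between the sign classes of an eigenvector for `-r` is at most `r ^ 2`,
then equality holds everywhere and the graph is determined outside the zeros. -/
theorem adj_structure_of_edgesBetween_le {x : V → ℝ} {r : ℝ} (hx0 : x ≠ 0) (hr : 0 < r)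
    (hx : ∀ u, ∑ v, G.adjMatrix ℝ u v * x v = -r * x u)
    (he : (G.edgesBetween {u | 0 ≤ x u} {u | x u < 0} : ℝ) ≤ r ^ 2) :
    (G.edgesBetween {u | 0 ≤ x u} {u | x u < 0} : ℝ) = r ^ 2 ∧
      (∀ u v, 0 ≤ x u → x v < 0 → (G.Adj u v ↔ 0 < x u)) ∧
      ∀ u v, 0 < x u * x v → ¬ G.Adj u v := by
  have h2 := two_mul_crossForm_eq hx
  have hS := sum_same_sign_nonneg (G := G) x
  have hN := sum_sq_posPart_add_sum_sq_negPart_pos hx0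
  have hdef := fun s => sum_sq_sub_smul_adjMatrix (G := G) {u | 0 ≤ x u} {u | x u < 0} x⁺ x⁻ s
  rw [sum_posPart_sq_filter, sum_negPart_sq_filter] at hdef
  set F := G.crossForm {u | 0 ≤ x u} {u | x u < 0} x⁺ x⁻ with hF
  set P := ∑ u, x⁺ u ^ 2
  set Q := ∑ u, x⁻ u ^ 2
  set E := (G.edgesBetween {u | 0 ≤ x u} {u | x u < 0} : ℝ)
  set S := ∑ u, ∑ v, G.adjMatrix ℝ u v * (x⁺ u * x⁺ v + x⁻ u * x⁻ v) with hSdef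
  have hrN : 0 < r * (P + Q) := by positivity
  have hFpos : 0 < F := by linarith
  -- This s minimizes the defect PQ - 2sF + s²E when E = r². As 2F ≥ r(P + Q), the defect is then at
  -- most PQ - (P + Q)²/4 ≤ 0, so it vanishes.
  set s := F / r ^ 2 with hs
  have hspos : 0 < s := by positivity
  have hFs : F = s * r ^ 2 := by rw [hs]; field_simp
  have hD := hdef s
  have hD0 : 0 ≤ ∑ u with 0 ≤ x u, ∑ v with x v < 0, (x⁺ u * x⁻ v - s * G.adjMatrix ℝ u v) ^ 2 :=
    sum_nonneg fun u _ => sum_nonneg fun v _ => sq_nonneg _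
  have hsN : (P + Q) ≤ 2 * s * r := by
    have : r * (P + Q) ≤ r * (2 * s * r) := by nlinarith
    exact le_of_mul_le_mul_left this hr
  have hPQ : 4 * (P * Q) ≤ (2 * s * r) ^ 2 := by
    have := pow_le_pow_left₀ hN.le hsN 2
    nlinarith [sq_nonneg (P - Q)]
  have hEs : s ^ 2 * E ≤ s ^ 2 * r ^ 2 := by gcongr
  have hDzero : ∑ u with 0 ≤ x u, ∑ v with x v < 0,
      (x⁺ u * x⁻ v - s * G.adjMatrix ℝ u v) ^ 2 = 0 := by
    refine le_antisymm ?_ hD0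
    rw [hD, hFs]
    nlinarith
  have hEeq : E = r ^ 2 := by
    refine le_antisymm he (le_of_mul_le_mul_left (a := s ^ 2) ?_ (by positivity))
    rw [hDzero, hFs] at hD
    nlinarith
  have hSzero : S = 0 := by
    refine le_antisymm ?_ hS
    have h4 : P * Q = (s * r) ^ 2 := by
      rw [hDzero, hFs, hEeq] at hD
      linarith
    have h5 : 2 * (s * r) ≤ P + Q := by
      refine le_of_sq_le_sq ?_ hN.le
      nlinarith [sq_nonneg (P - Q)]
    have : r * (2 * (s * r)) ≤ r * (P + Q) := by gcongr
    nlinarith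
  refine ⟨hEeq, fun u v hu hv => ?_, fun u v huv hadj => ?_⟩
  · have h6 : ∀ u, 0 ≤ x u → ∀ v, x v < 0 → x⁺ u * x⁻ v - s * G.adjMatrix ℝ u v = 0 := by
      intro u hu v hv
      have h7 := (sum_eq_zero_iff_of_nonneg fun u _ => sum_nonneg fun v _ => sq_nonneg _).1
        hDzero u (by simpa using hu)
      have h8 := (sum_eq_zero_iff_of_nonneg fun v _ => sq_nonneg _).1 h7 v (by simpa using hv)
      exact pow_eq_zero_iff two_ne_zero |>.1 h8
    have h9 := h6 u hu v hv
    have hv' : 0 < x⁻ v := negPart_pos hv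
    have hu' : x⁺ u = x u := posPart_eq_self.2 hu
    rw [hu'] at h9
    constructor
    · intro h
      rw [adjMatrix_apply, if_pos h] at h9
      exact pos_of_mul_pos_left (by linarith) hv'.le
    · intro h
      by_contra hn
      rw [adjMatrix_apply, if_neg hn] at h9
      have := mul_pos h hv'
      linarith
  · have hnn : ∀ u v, 0 ≤ G.adjMatrix ℝ u v * (x⁺ u * x⁺ v + x⁻ u * x⁻ v) := fun u v =>
      mul_nonneg (adjMatrix_nonneg u v)
        (add_nonneg (mul_nonneg (posPart_nonneg (x u)) (posPart_nonneg (x v)))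
        (mul_nonneg (negPart_nonneg (x u)) (negPart_nonneg (x v))))
    have h7 := (sum_eq_zero_iff_of_nonneg fun u _ => sum_nonneg fun v _ => hnn u v).1
        hSzero u (mem_univ u)
    have h8 := (sum_eq_zero_iff_of_nonneg fun v _ => hnn u v).1 h7 v (mem_univ v)
    rw [adjMatrix_apply, if_pos hadj, one_mul] at h8
    have hp := mul_nonneg (posPart_nonneg (x u)) (posPart_nonneg (x v))
    have hm := mul_nonneg (negPart_nonneg (x u)) (negPart_nonneg (x v))
    rw [← Pi.posPart_apply, ← Pi.posPart_apply] at hp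
    rw [← Pi.negPart_apply, ← Pi.negPart_apply] at hm
    rcases mul_pos_iff.1 huv with ⟨hu, hv⟩ | ⟨hu, hv⟩
    · have : 0 < x⁺ u * x⁺ v := mul_pos (posPart_pos hu) (posPart_pos hv)
      linarith
    · have : 0 < x⁻ u * x⁻ v := mul_pos (negPart_pos hu) (negPart_pos hv)
      linarith

/-- The spectral consequence of the extremal dichotomy for all bipartitions. -/
theorem leastEigenvalue_of_crossDichotomy [Nonempty V] {c : ℝ} (hc : 0 < c)
    (hD : ∀ A B : Finset V, Disjoint A B → #A + #B = Fintype.card V → G.CrossDichotomy A B c) :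
    -√c ≤ G.leastEigenvalue ∧ (G.leastEigenvalue = -√c → ∃ x : V → ℝ,
      ((#{u | 0 < x u} * #{u | x u < 0} : ℕ) : ℝ) = c ∧
        ∀ u v, x u ≠ 0 → (G.Adj u v ↔ x u * x v < 0)) := by
  obtain ⟨x, hx0, hx⟩ := mem_spectrum_adjMatrix_iff.1 G.isLeast_leastEigenvalue.1
  have hneg : ∀ u, ∑ v, G.adjMatrix ℝ u v * (-x) v = G.leastEigenvalue * (-x) u := fun u => by
    simp only [Pi.neg_apply, mul_neg, sum_neg_distrib, hx u]
  have hdisj : ∀ y : V → ℝ, G.CrossDichotomy {u | 0 ≤ y u} {u | y u < 0} c := fun y => by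
    have hfilter : univ.filter (fun u => y u < 0) = univ.filter fun u => ¬ 0 ≤ y u := by simp
    refine hD _ _ ?_ ?_
    · rw [hfilter]
      exact disjoint_filter_filter_not _ _ _
    · rw [hfilter, card_filter_add_card_filter_not, card_univ]
  have hedge : ∀ y : V → ℝ, y ≠ 0 → (∀ u, ∑ v, G.adjMatrix ℝ u v * y v =
      G.leastEigenvalue * y u) → G.leastEigenvalue ≤ -√c →
      (G.edgesBetween {u | 0 ≤ y u} {u | y u < 0} : ℝ) ≤ c := by
    intro y hy0 hy hle
    refine (hdisj y).resolve_right ?_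
    rintro ⟨c', h0, hlt, h⟩
    have h1 := h.sq_le (r := -G.leastEigenvalue) hy0 (by linarith [Real.sqrt_nonneg c]) h0
      (by simpa using hy)
    have h2 : √c ^ 2 ≤ (-G.leastEigenvalue) ^ 2 :=
      pow_le_pow_left₀ (Real.sqrt_nonneg c) (by linarith) 2
    rw [Real.sq_sqrt hc.le] at h2
    linarith
  have hsc := Real.sqrt_pos.2 hc
  constructor
  · by_contra! hlt
    have he := hedge x hx0 hx hlt.le
    have h2 : √c ^ 2 < (-G.leastEigenvalue) ^ 2 :=
      pow_lt_pow_left₀ (by linarith) (Real.sqrt_nonneg c) two_ne_zero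
    rw [Real.sq_sqrt hc.le] at h2
    -- Rigidity makes the edge count equal to r², although it is at most c < r².
    have := (adj_structure_of_edgesBetween_le (r := -G.leastEigenvalue) hx0 (by linarith)
      (by simpa using hx) (by linarith)).1
    linarith
  · intro heq
    have hsq := Real.sq_sqrt hc.le
    obtain ⟨h1, h2, h3⟩ := adj_structure_of_edgesBetween_le (r := √c) hx0 hsc
      (by simpa [heq] using hx) (hsq ▸ hedge x hx0 hx heq.le)
    -- Zeros of x are grouped with the positive entries, so x only separates them from the negative
    -- ones; -x separates them from the positive ones.
    obtain ⟨-, h2', -⟩ := adj_structure_of_edgesBetween_le (r := √c) (neg_ne_zero.2 hx0) hsc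
      (by simpa [heq] using hneg) (hsq ▸ hedge (-x) (neg_ne_zero.2 hx0) hneg heq.le)
    refine ⟨x, ?_, fun u v hu => ?_⟩
    · rw [← hsq, ← h1, Nat.cast_inj]
      have hsub : ({u | 0 < x u} : Finset V) ⊆ ({u | 0 ≤ x u} : Finset V) :=
        monotone_filter_right _ fun u _ h => le_of_lt h
      rw [edgesBetween, ← sum_subset_zero_on_sdiff hsub (f := fun _ => #{u | x u < 0}),
        sum_const, smul_eq_mul]
      · intro u hu
        simp only [mem_sdiff, mem_filter, mem_univ, true_and] at hu
        rw [degreeIn, card_eq_zero, filter_eq_empty_iff]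
        intro v hv hadj
        exact hu.2 ((h2 u v hu.1 (by simpa using hv)).1 hadj)
      · intro u hu
        have hu : 0 < x u := by simpa using hu
        rw [degreeIn, filter_true_of_mem (p := G.Adj u)]
        intro v hv
        exact (h2 u v hu.le (by simpa using hv)).2 hu
    · have h2'' : ∀ u v, x u ≤ 0 → 0 < x v → (G.Adj u v ↔ x u < 0) := by simpa using h2'
      rcases lt_trichotomy (x u) 0 with hu' | hu' | hu'
      · rcases lt_trichotomy (x v) 0 with hv | hv | hv
        · have := mul_pos_of_neg_of_neg hu' hv
          exact iff_of_false (h3 u v this) this.not_gt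
        · rw [G.adj_comm, h2 v u hv.ge hu', hv]; simp
        · exact iff_of_true ((h2'' u v hu'.le hv).2 hu') (mul_neg_of_neg_of_pos hu' hv)
      · exact absurd hu' hu
      · rcases lt_trichotomy (x v) 0 with hv | hv | hv
        · exact iff_of_true ((h2 u v hu'.le hv).2 hu') (mul_neg_of_pos_of_neg hu' hv)
        · rw [G.adj_comm, h2'' v u hv.le hu', hv]; simp
        · have := mul_pos hu' hv
          exact iff_of_false (h3 u v this) this.not_gt

end SimpleGraph

/-! ### Recognizing the extremal graphs and computing their eigenvalues. -/

namespace SimpleGraph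

/-- The function p(n - p) is strictly increasing for p ≤ n/2, so p < k would make the product too
small. -/
theorem eq_and_eq_of_mul_eq_mul_sub {n k p q : ℕ} (hk : 1 ≤ k) (hkn : 2 * k ≤ n)
    (hpq : p + q ≤ n) (hp : p ≤ k) (h : p * q = k * (n - k)) : p = k ∧ q = n - k := by
  obtain ⟨m, rfl⟩ : ∃ m, n = k + m := ⟨n - k, by omega⟩
  rw [Nat.add_sub_cancel_left] at h ⊢
  obtain ⟨d, rfl⟩ : ∃ d, k = p + d := ⟨k - p, by omega⟩
  rcases Nat.eq_zero_or_pos d with rfl | hd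
  · refine ⟨rfl, ?_⟩
    exact Nat.eq_of_mul_eq_mul_left (by omega) h
  · have : p * q ≤ p * (d + m) := Nat.mul_le_mul_left p (by omega)
    nlinarith

variable {V : Type*} [Fintype V] {G : SimpleGraph V}

/-- A graph whose vertices split into two classes so that adjacency means lying in different
classes is complete bipartite. -/
theorem nonempty_iso_completeBipartiteGraph {p q : ℕ} {P : V → Prop} [DecidablePred P]
    (hp : #{u | P u} = p) (hcard : p + q = Fintype.card V)
    (hadj : ∀ u v, G.Adj u v ↔ (P u ↔ ¬ P v)) :
    Nonempty (G ≃g completeBipartiteGraph (Fin p) (Fin q)) := by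
  have hq : Fintype.card {u // ¬ P u} = q := by
    rw [Fintype.card_subtype_compl, Fintype.card_subtype, hp]; omega
  have hp' : Fintype.card {u // P u} = p := by rw [Fintype.card_subtype, hp]
  let e : Fin p ⊕ Fin q ≃ V := ((Fintype.equivFinOfCardEq hp').symm.sumCongr
    (Fintype.equivFinOfCardEq hq).symm).trans (Equiv.sumCompl P)
  have he1 : ∀ i, P (e (Sum.inl i)) := fun i => by
    simpa [e] using ((Fintype.equivFinOfCardEq hp').symm i).2
  have he2 : ∀ i, ¬ P (e (Sum.inr i)) := fun i => by
    simpa [e] using ((Fintype.equivFinOfCardEq hq).symm i).2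
  refine ⟨Iso.symm ⟨e, ?_⟩⟩
  rintro (i | i) (j | j) <;> simp [hadj, he1, he2]

theorem nonempty_iso_completeBipartiteGraph_zero {n : ℕ} (hn : Fintype.card V = n)
    (h : ∀ u v, ¬ G.Adj u v) : Nonempty (G ≃g completeBipartiteGraph (Fin 0) (Fin n)) :=
  nonempty_iso_completeBipartiteGraph (P := fun _ => False) (by simp) (by omega)
    (by simpa using h)

variable [DecidableEq V]

theorem nonempty_iso_completeBipartiteGraph_sum {p q : ℕ} {P Q : V → Prop} [DecidablePred P]
    [DecidablePred Q] (hp : #{u | P u} = p) (hq : #{u | Q u} = q) (hPQ : ∀ u, P u → ¬ Q u)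
    (hcard : p + q + 1 = Fintype.card V)
    (hadj : ∀ u v, G.Adj u v ↔ (P u ∧ Q v ∨ Q u ∧ P v)) :
    Nonempty (G ≃g completeBipartiteGraph (Fin p) (Fin q) ⊕g (⊤ : SimpleGraph (Fin 1))) := by
  have hp' : Fintype.card {u // P u} = p := by rw [Fintype.card_subtype, hp]
  have hq' : Fintype.card {u // Q u} = q := by rw [Fintype.card_subtype, hq]
  have hr' : Fintype.card {u // ¬ (P u ∨ Q u)} = 1 := by
    have hdisj : Disjoint ({u | P u} : Finset V) ({u | Q u} : Finset V) :=
      disjoint_filter.2 fun u _ => hPQ u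
    rw [Fintype.card_subtype_compl, Fintype.card_subtype, filter_or, card_union_of_disjoint hdisj]
    omega
  let e1 := (Fintype.equivFinOfCardEq hp').symm
  let e2 := (Fintype.equivFinOfCardEq hq').symm
  let e3 := (Fintype.equivFinOfCardEq hr').symm
  let f : (Fin p ⊕ Fin q) ⊕ Fin 1 → V :=
    Sum.elim (Sum.elim (fun i => e1 i) fun i => e2 i) fun i => e3 i
  have hinj : Function.Injective f := by
    refine Function.Injective.sumElim (Function.Injective.sumElim
      (Subtype.val_injective.comp e1.injective) (Subtype.val_injective.comp e2.injective) ?_)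
      (Subtype.val_injective.comp e3.injective) ?_
    · exact fun i j h => hPQ _ (e1 i).2 (h ▸ (e2 j).2)
    · rintro (i | i) j h
      · exact (e3 j).2 (Or.inl (h ▸ (e1 i).2))
      · exact (e3 j).2 (Or.inr (h ▸ (e2 i).2))
  have hbij : Function.Bijective f :=
    (Fintype.bijective_iff_injective_and_card f).2 ⟨hinj, by simp [← hcard]⟩
  have hP1 : ∀ i, P (f (.inl (.inl i))) := fun i => (e1 i).2
  have hQ2 : ∀ i, Q (f (.inl (.inr i))) := fun i => (e2 i).2
  have hQ1 : ∀ i, ¬ Q (f (.inl (.inl i))) := fun i => hPQ _ (hP1 i)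
  have hP2 : ∀ i, ¬ P (f (.inl (.inr i))) := fun i h => hPQ _ h (hQ2 i)
  have hP3 : ∀ i, ¬ P (f (.inr i)) := fun i h => (e3 i).2 (Or.inl h)
  have hQ3 : ∀ i, ¬ Q (f (.inr i)) := fun i h => (e3 i).2 (Or.inr h)
  refine ⟨Iso.symm ⟨Equiv.ofBijective f hbij, ?_⟩⟩
  rintro ((i | i) | i) ((j | j) | j) <;> simp [hadj, hP1, hP2, hP3, hQ1, hQ2, hQ3]
  exact Subsingleton.elim i j

variable {x : V → ℝ}

theorem card_pos_add_card_neg_le (x : V → ℝ) :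
    #{u | 0 < x u} + #{u | x u < 0} ≤ Fintype.card V := by
  have hdisj : Disjoint ({u | 0 < x u} : Finset V) ({u | x u < 0} : Finset V) :=
    disjoint_filter.2 fun u _ h => h.le.not_gt
  rw [← card_union_of_disjoint hdisj]
  exact card_le_univ _

theorem ne_zero_of_card_pos_add_card_neg
    (h : #{u | 0 < x u} + #{u | x u < 0} = Fintype.card V) (u : V) : x u ≠ 0 := by
  have hdisj : Disjoint ({u | 0 < x u} : Finset V) ({u | x u < 0} : Finset V) :=
    disjoint_filter.2 fun u _ h => h.le.not_gt
  rw [← card_union_of_disjoint hdisj, card_eq_iff_eq_univ] at h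
  have := h ▸ mem_univ u
  rw [mem_union, mem_filter, mem_filter] at this
  rcases this with h | h
  exacts [h.2.ne', h.2.ne]

theorem nonempty_iso_completeBipartiteGraph_of_sign
    (hadj : ∀ u v, x u ≠ 0 → (G.Adj u v ↔ x u * x v < 0))
    (h : #{u | 0 < x u} + #{u | x u < 0} = Fintype.card V) :
    Nonempty (G ≃g completeBipartiteGraph (Fin #{u | 0 < x u}) (Fin #{u | x u < 0})) := by
  refine nonempty_iso_completeBipartiteGraph (P := fun u => 0 < x u) rfl h fun u v => ?_
  have hu := ne_zero_of_card_pos_add_card_neg h u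
  have hv := ne_zero_of_card_pos_add_card_neg h v
  rw [hadj u v hu, mul_neg_iff, not_lt, hv.le_iff_lt]
  rcases lt_or_gt_of_ne hu with hu | hu <;> rcases lt_or_gt_of_ne hv with hv | hv <;>
    simp [hu, hv, hu.not_gt, hv.not_gt]

/-- If one sign class has at most `k` elements and the classes have the extremal product of
sizes, then the graph is `K_{k, n - k}`. -/
theorem nonempty_iso_of_sign_of_card_le {n k : ℕ} (hn : Fintype.card V = n) (hk : 1 ≤ k)
    (hkn : 2 * k ≤ n) (hadj : ∀ u v, x u ≠ 0 → (G.Adj u v ↔ x u * x v < 0))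
    (hmul : #{u | 0 < x u} * #{u | x u < 0} = k * (n - k))
    (hle : #{u | 0 < x u} ≤ k ∨ #{u | x u < 0} ≤ k) :
    Nonempty (G ≃g completeBipartiteGraph (Fin k) (Fin (n - k))) := by
  have hsum := card_pos_add_card_neg_le x
  rcases hle with hle | hle
  · obtain ⟨h1, h2⟩ := eq_and_eq_of_mul_eq_mul_sub hk hkn (hn ▸ hsum) hle hmul
    have := nonempty_iso_completeBipartiteGraph_of_sign hadj (by omega)
    rwa [h1, h2] at this
  · obtain ⟨h1, h2⟩ := eq_and_eq_of_mul_eq_mul_sub hk hkn (by omega) hle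
      ((mul_comm _ _).trans hmul)
    have h1' : #{u | 0 < (-x) u} = k := by simpa using h1
    have h2' : #{u | (-x) u < 0} = n - k := by simpa using h2
    have := nonempty_iso_completeBipartiteGraph_of_sign (x := -x) (by simpa using hadj) (by omega)
    rwa [h1', h2'] at this

variable [DecidableRel G.Adj]

theorem leastEigenvalue_le_of_iso {W : Type*} [Fintype W] {H : SimpleGraph W} [DecidableRel H.Adj]
    (φ : G ≃g H) {x : W → ℝ} {μ : ℝ} (hx0 : x ≠ 0)
    (hx : ∀ w, ∑ z, H.adjMatrix ℝ w z * x z = μ * x w) : G.leastEigenvalue ≤ μ := by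
  obtain ⟨w, hw⟩ := Function.ne_iff.1 hx0
  have : Nonempty V := ⟨φ.symm w⟩
  refine G.isLeast_leastEigenvalue.2 (mem_spectrum_adjMatrix_iff.2 ⟨x ∘ φ, ?_, fun u => ?_⟩)
  · exact Function.ne_iff.2 ⟨φ.symm w, by simpa using hw⟩
  · rw [Function.comp_apply, ← hx (φ u), ← φ.toEquiv.sum_comp]
    refine sum_congr rfl fun v _ => ?_
    have : H.Adj (φ u) (φ v) ↔ G.Adj u v := φ.map_rel_iff
    simp [adjMatrix_apply, this]

theorem leastEigenvalue_le_of_iso_completeBipartiteGraph {p q : ℕ} (hp : 0 < p) (hq : 0 < q)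
    (φ : G ≃g completeBipartiteGraph (Fin p) (Fin q)) : G.leastEigenvalue ≤ -√((p : ℝ) * q) := by
  classical
  have hp' : √(p : ℝ) * √p = p := Real.mul_self_sqrt p.cast_nonneg
  have hq' : √(q : ℝ) * √q = q := Real.mul_self_sqrt q.cast_nonneg
  refine leastEigenvalue_le_of_iso φ (x := Sum.elim (fun _ => √q) fun _ => -√p)
    (Function.ne_iff.2 ⟨Sum.inl ⟨0, hp⟩, ?_⟩) ?_
  · simpa using hq.ne'
  · rw [Real.sqrt_mul p.cast_nonneg]
    rintro (i | j)
    · simp [adjMatrix_apply]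
      linear_combination -√(p : ℝ) * hq'
    · simp [adjMatrix_apply]
      linear_combination -√(q : ℝ) * hp'

theorem leastEigenvalue_le_of_iso_completeBipartiteGraph_sum {p q : ℕ} (hp : 0 < p) (hq : 0 < q)
    {W : Type*} [Fintype W] {H : SimpleGraph W}
    (φ : G ≃g completeBipartiteGraph (Fin p) (Fin q) ⊕g H) :
    G.leastEigenvalue ≤ -√((p : ℝ) * q) := by
  classical
  have hp' : √(p : ℝ) * √p = p := Real.mul_self_sqrt p.cast_nonneg
  have hq' : √(q : ℝ) * √q = q := Real.mul_self_sqrt q.cast_nonneg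
  refine leastEigenvalue_le_of_iso φ (x := Sum.elim (Sum.elim (fun _ => √q) fun _ => -√p) 0)
    (Function.ne_iff.2 ⟨Sum.inl (Sum.inl ⟨0, hp⟩), ?_⟩) ?_
  · simpa using hq.ne'
  · rw [Real.sqrt_mul p.cast_nonneg]
    rintro ((i | j) | w)
    · simp [adjMatrix_apply]
      linear_combination -√(p : ℝ) * hq'
    · simp [adjMatrix_apply]
      linear_combination -√(q : ℝ) * hp'
    · simp [adjMatrix_apply]

theorem leastEigenvalue_eq_zero_of_forall_not_adj [Nonempty V] (h : ∀ u v, ¬ G.Adj u v) :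
    G.leastEigenvalue = 0 := by
  obtain ⟨x, hx0, hx⟩ := mem_spectrum_adjMatrix_iff.1 G.isLeast_leastEigenvalue.1
  obtain ⟨u, hu⟩ := Function.ne_iff.1 hx0
  have := hx u
  simp only [adjMatrix_apply, h, if_false, zero_mul, sum_const_zero] at this
  exact (mul_eq_zero.1 this.symm).resolve_right hu

/-- The equality case in which both sign classes have more than `k` elements. -/
theorem nonempty_iso_sum_of_sign {n t k : ℕ} (hn : Fintype.card V = n) (hk : 1 ≤ k)
    (ht : t = 2 * k + 2 ∨ t = 2 * k + 3) (htn : t ≤ n) (hfree : (pathGraph t).Free G)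
    (hadj : ∀ u v, x u ≠ 0 → (G.Adj u v ↔ x u * x v < 0))
    (hmul : #{u | 0 < x u} * #{u | x u < 0} = k * (n - k))
    (hp : k < #{u | 0 < x u}) (hq : k < #{u | x u < 0}) :
    n = 5 ∧ t = 5 ∧ Nonempty (G ≃g completeBipartiteGraph (Fin 2) (Fin 2) ⊕g
      (⊤ : SimpleGraph (Fin 1))) := by
  have hdisj : Disjoint ({u | 0 < x u} : Finset V) ({u | x u < 0} : Finset V) :=
    disjoint_filter.2 fun u _ h => h.le.not_gt
  have hdp : ∀ u ∈ ({u | 0 < x u} : Finset V),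
      G.degreeIn {u | x u < 0} u = #{u | x u < 0} := by
    intro u hu
    have hu : 0 < x u := by simpa using hu
    rw [degreeIn, filter_true_of_mem (p := G.Adj u)]
    intro v hv
    exact (hadj u v hu.ne').2 (mul_neg_of_pos_of_neg hu (by simpa using hv))
  have hdq : ∀ u ∈ ({u | x u < 0} : Finset V),
      G.degreeIn {u | 0 < x u} u = #{u | 0 < x u} := by
    intro u hu
    have hu : x u < 0 := by simpa using hu
    rw [degreeIn, filter_true_of_mem (p := G.Adj u)]
    intro v hv
    exact (hadj u v hu.ne).2 (mul_neg_of_neg_of_pos hu (by simpa using hv))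
  have hdp' : ∀ u ∈ ({u | 0 < x u} : Finset V), k + 1 ≤ G.degreeIn {u | x u < 0} u :=
    fun u hu => (hdp u hu).symm ▸ hq
  have hdq' : ∀ u ∈ ({u | x u < 0} : Finset V), k + 1 ≤ G.degreeIn {u | 0 < x u} u :=
    fun u hu => (hdq u hu).symm ▸ hp
  obtain ⟨u, hu⟩ := card_pos.1 (k.zero_le.trans_lt hp)
  obtain ⟨v, hv⟩ := card_pos.1 (k.zero_le.trans_lt hq)
  obtain rfl : t = 2 * k + 3 := ht.resolve_left fun h =>
    not_free_pathGraph_even hdisj hdp' hdq' hu (h ▸ hfree)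
  have hq1 : #{u | x u < 0} = k + 1 := le_antisymm (not_lt.1 fun h =>
    not_free_pathGraph_odd_of_lt_degreeIn hdisj hdp' hdq' hu ((hdp u hu).symm ▸ h) hfree) hq
  have hp1 : #{u | 0 < x u} = k + 1 := le_antisymm (not_lt.1 fun h =>
    not_free_pathGraph_odd_of_lt_degreeIn hdisj.symm hdq' hdp' hv ((hdq v hv).symm ▸ h) hfree) hp
  rw [hp1, hq1] at hmul
  -- Since n ≥ 2k + 3, the equation (k + 1)² = k(k + 3 + m) reduces to k(1 + m) = 1.
  obtain ⟨m, hm⟩ : ∃ m, n - k = k + 3 + m := ⟨n - k - (k + 3), by omega⟩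
  rw [hm] at hmul
  obtain rfl : k = 1 := by nlinarith
  obtain rfl : m = 0 := by omega
  refine ⟨by omega, rfl, ?_⟩
  refine nonempty_iso_completeBipartiteGraph_sum (P := fun u => 0 < x u) (Q := fun u => x u < 0)
    hp1 hq1 (fun u h => h.le.not_gt) (by omega) fun u v => ?_
  by_cases hu0 : x u = 0
  · by_cases hv0 : x v = 0
    · simp only [hu0, hv0, lt_irrefl, false_and, or_self, iff_false]
      -- The sign pattern says nothing about edges among zeros of x, but four of the five vertices
      -- are nonzero.
      have hsub : #{w | x w = 0} ≤ 1 := by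
        have h1 : Disjoint ({w | 0 < x w ∨ x w < 0} : Finset V) ({w | x w = 0} : Finset V) :=
          disjoint_filter.2 fun w _ h h' => by simp [h'] at h
        have h2 := card_le_univ (({w | 0 < x w ∨ x w < 0} : Finset V) ∪
          ({w | x w = 0} : Finset V))
        rw [card_union_of_disjoint h1, filter_or, card_union_of_disjoint hdisj] at h2
        omega
      have := card_le_one.1 hsub u (by simpa using hu0) v (by simpa using hv0)
      exact fun h => h.ne this
    · rw [G.adj_comm, hadj v u hv0]
      simp [hu0]
  · rw [hadj u v hu0, mul_neg_iff]

end SimpleGraph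

/-! ### The two ranges of n. -/

open SimpleGraph in
theorem theorem1p4 {V : Type*} [Fintype V] [DecidableEq V] [Nonempty V]
    (G : SimpleGraph V) [DecidableRel G.Adj] (n t k : ℕ)
    (hn : Fintype.card V = n) (hk : k = (t - 2) / 2)
    (hfree : (SimpleGraph.pathGraph t).Free G) :
    (n < t →
      -√(((n / 2 : ℕ) : ℝ) * (((n + 1) / 2 : ℕ) : ℝ)) ≤ G.leastEigenvalue ∧
      (G.leastEigenvalue = -√(((n / 2 : ℕ) : ℝ) * (((n + 1) / 2 : ℕ) : ℝ)) ↔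
        Nonempty (G ≃g completeBipartiteGraph (Fin (n / 2)) (Fin ((n + 1) / 2))))) ∧
    (t ≤ n → t ≠ 3 →
      -√((k : ℝ) * ((n : ℝ) - (k : ℝ))) ≤ G.leastEigenvalue ∧
      (G.leastEigenvalue = -√((k : ℝ) * ((n : ℝ) - (k : ℝ))) ↔
        Nonempty (G ≃g completeBipartiteGraph (Fin k) (Fin (n - k))) ∨
        (n = 5 ∧ t = 5 ∧
          Nonempty (G ≃g (completeBipartiteGraph (Fin 2) (Fin 2) ⊕g
            (⊤ : SimpleGraph (Fin 1))))))) := by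
  have hn0 : 0 < n := hn ▸ Fintype.card_pos
  constructor
  · intro _
    rcases Nat.lt_or_ge n 2 with hn2 | hn2
    · obtain rfl : n = 1 := by omega
      have hsub : Subsingleton V := Fintype.card_le_one_iff_subsingleton.1 hn.le
      have hno : ∀ u v, ¬ G.Adj u v := fun u v h => h.ne (Subsingleton.elim u v)
      have h0 := leastEigenvalue_eq_zero_of_forall_not_adj hno
      have h1 := nonempty_iso_completeBipartiteGraph_zero hn hno
      exact ⟨by simp [h0], iff_of_true (by simp [h0]) h1⟩
    · have hhalf : (n + 1) / 2 = n - n / 2 := by omega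
      have hpos : 0 < n / 2 := by omega
      have hpos' : 0 < (n + 1) / 2 := by omega
      have hD : ∀ A B : Finset V, Disjoint A B → #A + #B = Fintype.card V →
          G.CrossDichotomy A B (((n / 2 : ℕ) : ℝ) * (((n + 1) / 2 : ℕ) : ℝ)) := by
        intro A B _ hcard
        left
        rw [← Nat.cast_mul, Nat.cast_le]
        refine (edgesBetween_le_card_mul_card A B).trans ?_
        obtain ⟨a, ha⟩ : ∃ a, n / 2 = a := ⟨_, rfl⟩
        obtain ⟨b, hb⟩ : ∃ b, (n + 1) / 2 = b := ⟨_, rfl⟩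
        rw [ha, hb]
        have hab : b = a ∨ b = a + 1 := by omega
        have hs : #A + #B = a + b := by omega
        zify at hs ⊢
        have hB : (#B : ℤ) = a + b - #A := by linarith
        rw [hB]
        rcases hab with rfl | rfl
        · nlinarith [sq_nonneg ((#A : ℤ) - b)]
        -- Here a(a + 1) exceeds the product by (#A - a)(#A - a - 1), a product of consecutive
        -- integers, hence the split at a.
        · push_cast
          rcases le_or_gt (#A : ℤ) a with h | h
          · nlinarith
          · nlinarith
      obtain ⟨h1, h2⟩ := leastEigenvalue_of_crossDichotomy (by positivity) hD
      refine ⟨h1, fun h => ?_, fun ⟨φ⟩ => ?_⟩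
      · obtain ⟨x, hmul, hadj⟩ := h2 h
        rw [← Nat.cast_mul, Nat.cast_inj] at hmul
        have hsum := card_pos_add_card_neg_le x
        rw [hhalf] at hmul ⊢
        exact nonempty_iso_of_sign_of_card_le hn hpos (by omega) hadj hmul (by omega)
      · exact le_antisymm (leastEigenvalue_le_of_iso_completeBipartiteGraph hpos hpos' φ) h1
  · intro htn ht3
    have ht2 : 2 ≤ t := by
      by_contra! h
      refine free_pathGraph_mono (t := 1) (by omega) hfree ?_
      exact not_free.1 (not_free_pathGraph_of_isChain (l := [Classical.arbitrary V])
        (by simp) (by simp))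
    rcases Nat.eq_zero_or_pos k with hk0 | hk1
    -- The value t = 3 also gives k = 0, but there a single edge is allowed and has eigenvalue -1;
    -- hence its exclusion.
    · obtain rfl : t = 2 := by omega
      subst hk0
      have hno : ∀ u v, ¬ G.Adj u v := fun u v h =>
        not_free_pathGraph_of_isChain (l := [u, v]) (by simpa using h) (by simpa using h.ne) hfree
      have h0 := leastEigenvalue_eq_zero_of_forall_not_adj hno
      have h1 := nonempty_iso_completeBipartiteGraph_zero hn hno
      exact ⟨by simp [h0], iff_of_true (by simp [h0]) (Or.inl h1)⟩
    · have ht : t = 2 * k + 2 ∨ t = 2 * k + 3 := by omega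
      have hcast : ((n - k : ℕ) : ℝ) = (n : ℝ) - k := Nat.cast_sub (by omega)
      have hpos' : 0 < n - k := by omega
      have hc : (0 : ℝ) < k * ((n : ℝ) - k) := by
        rw [← hcast]; positivity
      obtain ⟨h1, h2⟩ := leastEigenvalue_of_crossDichotomy hc fun A B hAB hcard =>
        crossDichotomy_of_free hk1 ht hfree htn hAB (hcard.trans hn)
      refine ⟨h1, fun h => ?_, ?_⟩
      · obtain ⟨x, hmul, hadj⟩ := h2 h
        rw [← hcast, ← Nat.cast_mul, Nat.cast_inj] at hmul
        by_cases hle : #{u | 0 < x u} ≤ k ∨ #{u | x u < 0} ≤ k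
        · exact Or.inl (nonempty_iso_of_sign_of_card_le hn hk1 (by omega) hadj hmul hle)
        · push Not at hle
          exact Or.inr (nonempty_iso_sum_of_sign hn hk1 ht htn hfree hadj hmul hle.1 hle.2)
      · rintro (⟨⟨φ⟩⟩ | ⟨rfl, rfl, ⟨φ⟩⟩)
        · refine le_antisymm ?_ h1
          rw [← hcast]
          exact leastEigenvalue_le_of_iso_completeBipartiteGraph hk1 hpos' φ
        · refine le_antisymm ?_ h1
          -- The two bounds agree because 2 · 2 = 1 · (5 - 1).
          refine (leastEigenvalue_le_of_iso_completeBipartiteGraph_sum two_pos two_pos φ).trans_eq ?_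
          rw [hk]
          norm_num
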